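/- **Setting.** Let $G\in\mathbb R^{n\times n}$, where $\mathbb R^{n\times n}$ carries the trace inner product and Frobenius norm. Let $\mathcal B:\mathbb R^{n\times n}\to\mathbb R^{2n}$, $\mathcal B(X)=\begin{pmatrix}Xe\\ X^Te\end{pmatrix}$ (row sums followed by column sums, $e$ the all-ones vector of $\mathbb R^n$), let $\mathcal B^*$ be its adjoint, $b\in\mathbb R^{2n}$ the all-ones vector, $C=\{X\in\mathbb R^{n\times n}\mid X\ge 0\ \text{entrywise}\}$, and $\Pi_C$ the metric projection onto $C$. Let $$\varphi(y)=\tfrac12\|\Pi_C(\mathcal B^*y+G)\|^2-\langle b,y\rangle-\tfrac12\|G\|^2,\qquad y\in\mathbb R^{2n};$$ the problem $\min\{\varphi(y)\mid y\in\mathrm{Ran}(\mathcal B)\}$ is the dual of projecting $G$ onto the Birkhoff polytope. For $y\in\mathbb R^{2n}$ let $\Omega(y)$ be the $0$-$1$ matrix with $\Omega(y)_{ij}=1$ if and only if $(\mathcal B^*y+G)_{ij}\ge 0$, and let $\mathcal V(y)d=\mathcal B\big(\Omega(y)\circ\mathcal B^*d\big)$ with $\circ$ the Hadamard product. **Algorithm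 Ssncg1.** Let $\mu\in(0,\tfrac12)$, $\bar\eta\in(0,1)$, $\tau_1,\tau_2\in(0,1)$, $\tau\in(0,1]$, $\delta\in(0,1)$ and $y^0\in\mathrm{Ran}(\mathcal B)$. For $j=0,1,2,\dots$: 1. Put $\varepsilon_j=\tau_1\min\{\tau_2,\|\nabla\varphi(y^j)\|\}$ and let $d^j$ be an iterate of the conjugate gradient method, started at the zero vector, for the linear system $(\mathcal V(y^j)+\varepsilon_jI)d=-\nabla\varphi(y^j)$, such that $$\|(\mathcal V(y^j)+\varepsilon_jI)d^j+\nabla\varphi(y^j)\|\le\min\big(\bar\eta,\ \|\nabla\varphi(y^j)\|^{1+\tau}\big).$$ 2. Let $m_j$ be the first nonnegative integer $m$ with $\varphi(y^j+\delta^md^j)\le\varphi(y^j)+\mu\,\delta^m\langle\nabla\varphi(y^j),d^j\rangle$, and put $\alpha_j=\delta^{m_j}$. 3. Put $y^{j+1}=y^j+\alpha_jd^j$. **Theorem.** Let $\bar y$ be an accumulation point of an infinite sequence $\{y^j\}$ generated by Algorithm Ssncg1. Assume that the constraint nondegeneracy condition $$\mathcal B\,\mathrm{lin}\big(\mathcal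 T_C(\widehat G)\big)=\mathrm{Ran}(\mathcal B)$$ holds at $\widehat G:=\Pi_C(\mathcal B^*\bar y+G)$, where $\mathcal T_C(\widehat G)$ is the tangent cone of $C$ at $\widehat G$ and $\mathrm{lin}(K)=K\cap(-K)$ is the lineality space of a cone $K$. Then the whole sequence $\{y^j\}$ converges to $\bar y$ and $$\|y^{j+1}-\bar y\|=O\big(\|y^j-\bar y\|^{1+\tau}\big)\qquad (j\to\infty).$$ -/

import Mathlib

open Filter Topology Asymptotics
open scoped Gradient RealInnerProductSpace

namespace Birkhoff

/-- The metric projection `Π_C` onto a set `C`: a nearest point of `C` (for a nonempty closed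
convex `C` there is exactly one). -/
noncomputable def metricProj {E : Type*} [NormedAddCommGroup E] (C : Set E) (x : E) : E :=
  Classical.epsilon (fun p => p ∈ C ∧ ∀ q ∈ C, ‖x - p‖ ≤ ‖x - q‖)

/-- The lineality space `K ∩ (-K)` of a cone `K`. -/
def lineality {E : Type*} [NormedAddCommGroup E] (K : Set E) : Set E :=
  {v | v ∈ K ∧ -v ∈ K}

/-- `n × n` real matrices with the Frobenius (trace) inner product; `X (i, j)` is the entry in
row `i` and column `j`. -/
abbrev Mat (n : ℕ) : Type := EuclideanSpace ℝ (Fin n × Fin n)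

/-- `ℝ^{2n}` with the Euclidean inner product; `Sum.inl i` is the coordinate `i` and
`Sum.inr j` the coordinate `n + j`. -/
abbrev Dual (n : ℕ) : Type := EuclideanSpace ℝ (Fin n ⊕ Fin n)

/-- The operator `ℬ` sending a matrix to its row sums followed by its column sums. -/
noncomputable def opB (n : ℕ) : Mat n →ₗ[ℝ] Dual n where
  toFun X := WithLp.toLp 2 (Sum.elim (fun i => ∑ j, X (i, j)) (fun j => ∑ i, X (i, j)))
  map_add' X Y := by
    ext k
    rcases k with i | j <;> simp [Finset.sum_add_distrib]
  map_smul' c X := by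
    ext k
    rcases k with i | j <;> simp [Finset.mul_sum]

/-- The adjoint `ℬ*`. -/
noncomputable def opBadj (n : ℕ) : Dual n →ₗ[ℝ] Mat n := LinearMap.adjoint (opB n)

/-- The all-ones vector `b` of `ℝ^{2n}`. -/
noncomputable def rhs (n : ℕ) : Dual n := WithLp.toLp 2 (fun _ => 1)

/-- The cone `C` of entrywise nonnegative matrices. -/
def nonnegCone (n : ℕ) : Set (Mat n) := {X | ∀ p, 0 ≤ X p}

/-- The projection onto the nonnegative cone is the entrywise positive part. -/
theorem metricProj_nonnegCone (n : ℕ) (X : Mat n) :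
    metricProj (nonnegCone n) X = WithLp.toLp 2 (fun p => max (X p) 0) := by
  have key : ∀ q ∈ nonnegCone n,
      ‖X - WithLp.toLp 2 (fun p => max (X p) 0)‖ ^ 2
        + ‖q - WithLp.toLp 2 (fun p => max (X p) 0)‖ ^ 2 ≤ ‖X - q‖ ^ 2 := by
    intro q hq
    simp only [EuclideanSpace.norm_sq_eq, ← Finset.sum_add_distrib]
    refine Finset.sum_le_sum fun p _ => ?_
    have := hq p
    simp only [PiLp.sub_apply, Real.norm_eq_abs, sq_abs]
    rcases le_total (X p) 0 with h | h
    · rw [max_eq_right h]; nlinarith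
    · rw [max_eq_left h]; nlinarith
  have hmem : (WithLp.toLp 2 (fun p => max (X p) 0) : Mat n) ∈ nonnegCone n :=
    fun p => le_max_right _ _
  have hex : ∃ p : Mat n, p ∈ nonnegCone n ∧ ∀ q ∈ nonnegCone n, ‖X - p‖ ≤ ‖X - q‖ := by
    refine ⟨_, hmem, fun q hq => ?_⟩
    have h1 := key q hq
    exact le_of_sq_le_sq (by nlinarith [sq_nonneg ‖q - WithLp.toLp 2 (fun p => max (X p) 0)‖])
      (norm_nonneg _)
  have hs : metricProj (nonnegCone n) X ∈ nonnegCone n ∧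
      ∀ q ∈ nonnegCone n, ‖X - metricProj (nonnegCone n) X‖ ≤ ‖X - q‖ :=
    Classical.epsilon_spec hex
  have h1 := key _ hs.1
  have h2 := hs.2 _ hmem
  have h3 := pow_le_pow_left₀ (norm_nonneg _) h2 2
  have h4 := pow_eq_zero_iff (n := 2) (by norm_num) |>.1
    (le_antisymm (by linarith) (sq_nonneg
      ‖metricProj (nonnegCone n) X - WithLp.toLp 2 (fun p => max (X p) 0)‖))
  exact sub_eq_zero.1 (norm_eq_zero.1 h4)

/-- The dual objective `φ(y) = ½‖Π_C(ℬ* y + G)‖² - ⟨b, y⟩ - ½‖G‖²`. -/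
noncomputable def dualObj {n : ℕ} (G : Mat n) (y : Dual n) : ℝ :=
  (1 / 2) * ‖metricProj (nonnegCone n) (opBadj n y + G)‖ ^ 2 - ⟪rhs n, y⟫ - (1 / 2) * ‖G‖ ^ 2

/-- The operator `H ↦ Ω ∘ H` (Hadamard product), where `Ω_{ij} = 1` if `X_{ij} ≥ 0` and
`Ω_{ij} = 0` otherwise. -/
noncomputable def opU {n : ℕ} (X : Mat n) : Mat n →ₗ[ℝ] Mat n where
  toFun H := WithLp.toLp 2 (fun p => (if 0 ≤ X p then (1 : ℝ) else 0) * H p)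
  map_add' H K := by
    ext p
    simp [mul_add]
  map_smul' c H := by
    ext p
    simp

/-- The operator `𝒱 = ℬ 𝒰 ℬ*` at `y`. -/
noncomputable def opV {n : ℕ} (G : Mat n) (y : Dual n) : Dual n →ₗ[ℝ] Dual n :=
  opB n ∘ₗ opU (opBadj n y + G) ∘ₗ opBadj n

/-- The coefficient operator `𝒱 + ε I` of the Newton system at `y`, with
`ε = τ₁ min(τ₂, ‖∇φ(y)‖)`. -/
noncomputable def newtonOp {n : ℕ} (G : Mat n) (τ₁ τ₂ : ℝ) (y : Dual n) :
    Dual n →ₗ[ℝ] Dual n :=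
  opV G y + (τ₁ * min τ₂ ‖∇ (dualObj G) y‖) • LinearMap.id

/-- Current iterate, residual and search direction of the conjugate gradient method. -/
structure CGState (E : Type*) where
  x : E
  r : E
  p : E

/-- One iteration of the conjugate gradient method for `A x = c`. When the residual is already
zero, the iterate is not changed (both quotients are then `0 / 0 = 0`). -/
noncomputable def cgStep {E : Type*} [NormedAddCommGroup E] [InnerProductSpace ℝ E]
    (A : E →ₗ[ℝ] E) (s : CGState E) : CGState E :=
  let α : ℝ := ⟪s.r, s.r⟫ / ⟪s.p, A s.p⟫
  let r' : E := s.r - α • A s.p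
  let β : ℝ := ⟪r', r'⟫ / ⟪s.r, s.r⟫
  { x := s.x + α • s.p, r := r', p := r' + β • s.p }

/-- The `k`-th iterate of the conjugate gradient method for `A x = c` started at `0`. -/
noncomputable def cgIterate {E : Type*} [NormedAddCommGroup E] [InnerProductSpace ℝ E]
    (A : E →ₗ[ℝ] E) (c : E) (k : ℕ) : E :=
  ((cgStep A)^[k] { x := 0, r := c, p := c }).x

/-- `d` is an inexact Newton direction at `y`: a conjugate gradient iterate for
`(𝒱 + ε I) d = -∇φ(y)` whose residual is at most `min(η, ‖∇φ(y)‖^{1+τ})`. -/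
def IsNewtonDirection {n : ℕ} (G : Mat n) (η τ₁ τ₂ τ : ℝ) (y d : Dual n) : Prop :=
  (∃ k : ℕ, d = cgIterate (newtonOp G τ₁ τ₂ y) (-∇ (dualObj G) y) k) ∧
  ‖newtonOp G τ₁ τ₂ y d + ∇ (dualObj G) y‖ ≤ min η (‖∇ (dualObj G) y‖ ^ (1 + τ))

/-- `m` is the first nonnegative integer that satisfies the line search inequality. -/
def IsLineSearchExponent {n : ℕ} (G : Mat n) (μ δ : ℝ) (y d : Dual n) (m : ℕ) : Prop :=
  IsLeast {i : ℕ | dualObj G (y + δ ^ i • d) ≤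
    dualObj G y + μ * δ ^ i * ⟪∇ (dualObj G) y, d⟫} m

/-- `y` is an infinite sequence generated by the semismooth Newton-CG algorithm. -/
structure IsSsncgSequence {n : ℕ} (G : Mat n) (μ η τ₁ τ₂ τ δ : ℝ) (y : ℕ → Dual n) : Prop where
  init : y 0 ∈ LinearMap.range (opB n)
  step : ∀ j : ℕ, ∃ (d : Dual n) (m : ℕ), IsNewtonDirection G η τ₁ τ₂ τ (y j) d ∧
    IsLineSearchExponent G μ δ (y j) d m ∧ y (j + 1) = y j + δ ^ m • d

/-- Constraint nondegeneracy `ℬ lin(T_C(X)) = Ran(ℬ)`, with `T_C(X)` the tangent cone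
of `C` at `X`. -/
def ConstraintNondegenerate {n : ℕ} (X : Mat n) : Prop :=
  opB n '' lineality (posTangentConeAt (nonnegCone n) X) = Set.range (opB n)

end Birkhoff

/-! The function `φ` is convex and piecewise quadratic, with gradient `ℬ Π_C(ℬ* y + G) - b`. Near
`ybar` only entries that vanish at `ybar` can change sign, so `∇φ(y) - ∇φ(ybar) = 𝒱(y)(y - ybar)`
holds without remainder.

A CG iterate `d` started at zero satisfies `⟨d, A d⟩ = ⟨c, d⟩` (`inner_cgIterate`). Hence `⟨∇φ(y),
d⟩ = -⟨𝒱 d, d⟩ - ε‖d‖²`, and every direction is a descent direction. At a non-stationary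
accumulation point the decrease per step would be bounded below (`exists_decrease`), so `∇φ(ybar) =
0`.

Nondegeneracy makes `𝒱(y)` uniformly coercive on `Ran(ℬ)`, where all iterates stay
(`ConstraintNondegenerate.exists_coercive`). This bounds the error of a full Newton step by a
multiple of `‖y - ybar‖ ^ (1 + τ)` (`exists_newton_contraction`), and so strong a contraction makes
the line search accept the unit step (`exists_unit_step`). Once an iterate enters a small ball
around `ybar`, the rest are trapped and converge. -/

namespace Birkhoff

/-! ### Orthogonality in the conjugate gradient method -/

section ConjugateGradient

variable {E : Type*} [NormedAddCommGroup E] [InnerProductSpace ℝ E]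

/-- The orthogonality relations of the conjugate gradient method; `S` plays the role of the span
of the previous search directions. -/
structure CGInvariant (A : E →ₗ[ℝ] E) (c : E) (s : CGState E) (S : Submodule ℝ E) : Prop where
  x_mem : s.x ∈ S
  residual : s.r = c - A s.x
  r_orth : ∀ v ∈ S, ⟪s.r, v⟫ = 0
  p_conj : ∀ v ∈ S, ⟪A s.p, v⟫ = 0
  r_inner_p : ⟪s.r, s.p⟫ = ⟪s.r, s.r⟫
  p_eq_zero : s.r = 0 → s.p = 0
  c_mem : ∃ a : ℝ, c - a • s.p ∈ S
  map_mem : ∀ v ∈ S, ∃ a : ℝ, A v - a • s.p ∈ S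

theorem CGInvariant.init (A : E →ₗ[ℝ] E) (c : E) :
    CGInvariant A c { x := 0, r := c, p := c } ⊥ where
  x_mem := by simp
  residual := by simp
  r_orth := by simp
  p_conj := by simp
  r_inner_p := rfl
  p_eq_zero := id
  c_mem := ⟨1, by simp⟩
  map_mem := by
    intro v hv
    rw [Submodule.mem_bot] at hv
    exact ⟨0, by simp [hv]⟩

/-- Adding the current direction to `S` gives the next Krylov space, and `A` maps `S` into it.
Symmetry thus turns orthogonality of the new residual into conjugacy against `S`; the choices of `α`
and `β` handle the remaining direction `s.p`. -/
theorem CGInvariant.step {A : E →ₗ[ℝ] E} (hA : A.IsSymmetric) (hpos : ∀ v ≠ 0, 0 < ⟪v, A v⟫)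
    {c : E} {s : CGState E} {S : Submodule ℝ E} (h : CGInvariant A c s S) :
    ∃ S', CGInvariant A c (cgStep A s) S' := by
  by_cases hr : s.r = 0
  · have hp := h.p_eq_zero hr
    refine ⟨S, ?_⟩
    have hs : cgStep A s = s := by
      obtain ⟨x, r, p⟩ := s
      simp only at hr hp
      subst hr hp
      simp [cgStep]
    rwa [hs]
  have hrr : ⟪s.r, s.r⟫ ≠ 0 := inner_self_ne_zero.2 hr
  have hp : s.p ≠ 0 := by
    intro h0
    apply hrr
    rw [← h.r_inner_p, h0, inner_zero_right]
  have hpp : ⟪s.p, A s.p⟫ ≠ 0 := (hpos _ hp).ne'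
  set α : ℝ := ⟪s.r, s.r⟫ / ⟪s.p, A s.p⟫ with hα
  set r' : E := s.r - α • A s.p with hr'
  set β : ℝ := ⟪r', r'⟫ / ⟪s.r, s.r⟫ with hβ
  have hα0 : α ≠ 0 := div_ne_zero hrr hpp
  have hstep : cgStep A s = { x := s.x + α • s.p, r := r', p := r' + β • s.p } := rfl
  set S' : Submodule ℝ E := S ⊔ Submodule.span ℝ {s.p} with hS'
  have hSS' : S ≤ S' := le_sup_left
  have hpS' : s.p ∈ S' := le_sup_right (a := S) (Submodule.mem_span_singleton_self _)
  have hmem : ∀ {v : E}, (∃ a : ℝ, v - a • s.p ∈ S) → v ∈ S' := by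
    rintro v ⟨a, ha⟩
    have := S'.add_mem (hSS' ha) (S'.smul_mem a hpS')
    rwa [sub_add_cancel] at this
  have hdecomp : ∀ v ∈ S', ∃ w ∈ S, ∃ a : ℝ, v = w + a • s.p := by
    intro v hv
    obtain ⟨w, hw, u, hu, rfl⟩ := Submodule.mem_sup.1 hv
    obtain ⟨a, rfl⟩ := Submodule.mem_span_singleton.1 hu
    exact ⟨w, hw, a, rfl⟩
  have hcS' : c ∈ S' := hmem h.c_mem
  have hrS' : s.r ∈ S' := by
    rw [h.residual]
    exact S'.sub_mem hcS' (hmem (h.map_mem _ h.x_mem))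
  have hr'p : ⟪r', s.p⟫ = 0 := by
    rw [hr', inner_sub_left, inner_smul_left, h.r_inner_p, real_inner_comm]
    simp only [conj_trivial]
    rw [hα, real_inner_comm s.p, div_mul_cancel₀ _ hpp, real_inner_comm]
    simp
  have hr'S' : ∀ v ∈ S', ⟪r', v⟫ = 0 := by
    intro v hv
    obtain ⟨w, hw, a, rfl⟩ := hdecomp v hv
    rw [inner_add_right, inner_smul_right, hr'p, hr', inner_sub_left, inner_smul_left,
      h.r_orth w hw, h.p_conj w hw]
    simp
  have hAp : A s.p = α⁻¹ • (s.r - r') := by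
    rw [hr', sub_sub_cancel, smul_smul, inv_mul_cancel₀ hα0, one_smul]
  have hr'Ap : ⟪r', A s.p⟫ = -(α⁻¹ * ⟪r', r'⟫) := by
    rw [hAp, inner_smul_right, inner_sub_right, hr'S' _ hrS']
    ring
  refine ⟨S', ?_⟩
  rw [hstep]
  refine ⟨S'.add_mem (hSS' h.x_mem) (S'.smul_mem _ hpS'), ?_, hr'S', ?_, ?_, ?_, ⟨0, ?_⟩, ?_⟩
  · simp only [map_add, map_smul, hr', h.residual]
    abel
  · intro v hv
    obtain ⟨w, hw, a, rfl⟩ := hdecomp v hv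
    have h1 : ⟪A (r' + β • s.p), w⟫ = 0 := by
      rw [map_add, map_smul, inner_add_left, inner_smul_left, h.p_conj w hw, hA r' w,
        hr'S' _ (hmem (h.map_mem w hw))]
      simp
    have h2 : ⟪A (r' + β • s.p), s.p⟫ = 0 := by
      rw [hA, inner_add_left, inner_smul_left, hr'Ap, hβ, hα]
      simp only [conj_trivial]
      field_simp
      ring
    rw [inner_add_right, inner_smul_right, h1, h2]
    simp
  · simp only [inner_add_right, inner_smul_right, hr'p, mul_zero, add_zero]
  · intro h0
    simp only at h0
    simp [hβ, h0]
  · simpa using hcS'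
  · intro v hv
    obtain ⟨w, hw, a, rfl⟩ := hdecomp v hv
    refine ⟨-(a * α⁻¹), ?_⟩
    have : A (w + a • s.p) - (-(a * α⁻¹)) • (r' + β • s.p)
        = A w + (a * α⁻¹) • s.r + (a * α⁻¹ * β) • s.p := by
      rw [map_add, map_smul, hAp]
      module
    rw [this]
    exact S'.add_mem (S'.add_mem (hmem (h.map_mem w hw)) (S'.smul_mem _ hrS')) (S'.smul_mem _ hpS')

/-- A conjugate gradient iterate is orthogonal to its residual. -/
theorem inner_cgIterate {A : E →ₗ[ℝ] E} (hA : A.IsSymmetric) (hpos : ∀ v ≠ 0, 0 < ⟪v, A v⟫)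
    (c : E) (k : ℕ) :
    ⟪cgIterate A c k, A (cgIterate A c k)⟫ = ⟪c, cgIterate A c k⟫ := by
  have key : ∃ S, CGInvariant A c ((cgStep A)^[k] { x := 0, r := c, p := c }) S := by
    induction k with
    | zero => exact ⟨⊥, CGInvariant.init A c⟩
    | succ k ih =>
      obtain ⟨S, hS⟩ := ih
      rw [Function.iterate_succ_apply']
      exact hS.step hA hpos
  obtain ⟨S, hS⟩ := key
  have h1 := hS.r_orth _ hS.x_mem
  rw [hS.residual, inner_sub_left, sub_eq_zero] at h1
  unfold cgIterate
  rw [h1, real_inner_comm]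

theorem cgIterate_mem {A : E →ₗ[ℝ] E} {R : Submodule ℝ E} (hR : ∀ v ∈ R, A v ∈ R) {c : E}
    (hc : c ∈ R) (k : ℕ) : cgIterate A c k ∈ R := by
  have key : ((cgStep A)^[k] { x := 0, r := c, p := c }).x ∈ R ∧
      ((cgStep A)^[k] { x := 0, r := c, p := c }).r ∈ R ∧
      ((cgStep A)^[k] { x := 0, r := c, p := c }).p ∈ R := by
    induction k with
    | zero => exact ⟨R.zero_mem, hc, hc⟩
    | succ k ih =>
      obtain ⟨h1, h2, h3⟩ := ih
      rw [Function.iterate_succ_apply']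
      have h4 := R.sub_mem h2 (R.smul_mem
        (⟪((cgStep A)^[k] { x := 0, r := c, p := c }).r,
          ((cgStep A)^[k] { x := 0, r := c, p := c }).r⟫ /
          ⟪((cgStep A)^[k] { x := 0, r := c, p := c }).p,
            A ((cgStep A)^[k] { x := 0, r := c, p := c }).p⟫) (hR _ h3))
      exact ⟨R.add_mem h1 (R.smul_mem _ h3), h4, R.add_mem h4 (R.smul_mem _ h3)⟩
  exact key.1

theorem cgIterate_zero_right (A : E →ₗ[ℝ] E) (k : ℕ) : cgIterate A 0 k = 0 := by
  have := cgIterate_mem (A := A) (R := ⊥) (by simp) (Submodule.zero_mem _) k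
  simpa using this

end ConjugateGradient

/-! ### Gradient and generalized Hessian of the dual objective -/

variable {n : ℕ}

/-- The entrywise positive part. -/
noncomputable def matPos (X : Mat n) : Mat n := WithLp.toLp 2 (fun p => max (X p) 0)

/-- The residual `ℬ Π_C(ℬ* y + G) - b`, which is the gradient of the dual objective. -/
noncomputable def dualGrad (G : Mat n) (y : Dual n) : Dual n :=
  opB n (matPos (opBadj n y + G)) - rhs n

theorem inner_mat (X Y : Mat n) : ⟪X, Y⟫ = ∑ p, X p * Y p := by
  rw [PiLp.inner_apply]
  exact Finset.sum_congr rfl fun p _ => by simp [mul_comm]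

theorem inner_opB (X : Mat n) (d : Dual n) : ⟪opB n X, d⟫ = ∑ p, X p * opBadj n d p := by
  rw [← inner_mat, opBadj, LinearMap.adjoint_inner_right]

theorem norm_sq_mat (X : Mat n) : ‖X‖ ^ 2 = ∑ p, X p ^ 2 := by
  rw [EuclideanSpace.norm_sq_eq]
  exact Finset.sum_congr rfl fun p _ => by simp

theorem exists_bound_opBadj (n : ℕ) : ∃ L > 0, ∀ d : Dual n, ‖opBadj n d‖ ^ 2 ≤ L * ‖d‖ ^ 2 := by
  obtain ⟨M, hM, h⟩ := (LinearMap.toContinuousLinearMap (opBadj n)).bound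
  refine ⟨M ^ 2, by positivity, fun d => ?_⟩
  rw [← mul_pow]
  exact pow_le_pow_left₀ (norm_nonneg _) (h d) 2

theorem dualObj_add (G : Mat n) (y h : Dual n) :
    dualObj G (y + h) - dualObj G y - ⟪dualGrad G y, h⟫ =
      (1 / 2) * ∑ p, (max ((opBadj n y + G) p + opBadj n h p) 0 ^ 2 - max ((opBadj n y + G) p) 0 ^ 2
        - 2 * (max ((opBadj n y + G) p) 0 * opBadj n h p)) := by
  have h1 : opBadj n (y + h) + G = (opBadj n y + G) + opBadj n h := by
    rw [map_add]; abel
  simp only [dualObj, dualGrad, metricProj_nonnegCone, norm_sq_mat, inner_sub_left, inner_add_right,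
    inner_opB, h1, Finset.sum_sub_distrib, ← Finset.mul_sum, matPos, PiLp.add_apply]
  ring

/-- The function `t ↦ max t 0 ^ 2` is convex and its derivative `2 * max t 0` is 2-Lipschitz. -/
theorem sq_max_add_bounds (a h : ℝ) :
    0 ≤ max (a + h) 0 ^ 2 - max a 0 ^ 2 - 2 * (max a 0 * h) ∧
      max (a + h) 0 ^ 2 - max a 0 ^ 2 - 2 * (max a 0 * h) ≤ h ^ 2 := by
  rcases le_total a 0 with ha | ha <;> rcases le_total (a + h) 0 with hb | hb <;>
    simp only [max_eq_left, max_eq_right, ha, hb] <;> constructor <;> nlinarith [sq_nonneg h]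

theorem dualObj_add_bounds (G : Mat n) (y h : Dual n) :
    0 ≤ dualObj G (y + h) - dualObj G y - ⟪dualGrad G y, h⟫ ∧
      dualObj G (y + h) - dualObj G y - ⟪dualGrad G y, h⟫ ≤ (1 / 2) * ‖opBadj n h‖ ^ 2 := by
  rw [dualObj_add, norm_sq_mat]
  exact ⟨mul_nonneg (by norm_num) (Finset.sum_nonneg fun p _ => (sq_max_add_bounds _ _).1),
    mul_le_mul_of_nonneg_left (Finset.sum_le_sum fun p _ => (sq_max_add_bounds _ _).2)
      (by norm_num)⟩

theorem hasGradientAt_dualObj (G : Mat n) (y : Dual n) :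
    HasGradientAt (dualObj G) (dualGrad G y) y := by
  obtain ⟨L, hL, hb⟩ := exists_bound_opBadj n
  rw [hasGradientAt_iff_isLittleO_nhds_zero]
  have h1 : (fun h => dualObj G (y + h) - dualObj G y - ⟪dualGrad G y, h⟫) =O[𝓝 0]
      fun h : Dual n => ‖h‖ ^ 2 := by
    refine IsBigO.of_bound (L / 2) (Eventually.of_forall fun h => ?_)
    obtain ⟨h0, h2⟩ := dualObj_add_bounds G y h
    rw [Real.norm_of_nonneg h0, Real.norm_of_nonneg (by positivity)]
    linarith [hb h]
  exact h1.trans_isLittleO (isLittleO_norm_pow_id one_lt_two)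

theorem gradient_dualObj (G : Mat n) : ∇ (dualObj G) = dualGrad G :=
  funext fun y => (hasGradientAt_dualObj G y).gradient

theorem continuous_dualObj (G : Mat n) : Continuous (dualObj G) :=
  continuous_iff_continuousAt.2 fun y => (hasGradientAt_dualObj G y).continuousAt

theorem continuous_opBadj_add (G : Mat n) : Continuous fun y => opBadj n y + G :=
  (opBadj n).continuous_of_finiteDimensional.add continuous_const

theorem continuous_dualGrad (G : Mat n) : Continuous (dualGrad G) := by
  refine ((opB n).continuous_of_finiteDimensional.comp ?_).sub continuous_const
  refine (PiLp.continuous_toLp 2 _).comp (continuous_pi fun p => ?_)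
  have h := continuous_opBadj_add G
  exact (((continuous_apply p).comp (PiLp.continuous_ofLp 2 _)).comp h).max continuous_const

theorem rhs_mem_range (n : ℕ) : rhs n ∈ LinearMap.range (opB n) := by
  -- The identity matrix is doubly stochastic.
  refine ⟨WithLp.toLp 2 (fun p => if p.1 = p.2 then 1 else 0), ?_⟩
  ext k
  rcases k with i | j <;> simp [opB, rhs]

theorem dualGrad_mem_range (G : Mat n) (y : Dual n) :
    dualGrad G y ∈ LinearMap.range (opB n) :=
  Submodule.sub_mem _ (LinearMap.mem_range_self _ _) (rhs_mem_range n)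

theorem opV_mem_range (G : Mat n) (y d : Dual n) : opV G y d ∈ LinearMap.range (opB n) :=
  LinearMap.mem_range_self _ _

theorem inner_opV (G : Mat n) (y d e : Dual n) :
    ⟪opV G y d, e⟫ =
      ∑ p, (if 0 ≤ (opBadj n y + G) p then (1 : ℝ) else 0) * (opBadj n d p * opBadj n e p) := by
  simp only [opV, LinearMap.comp_apply, inner_opB, opU, LinearMap.coe_mk, AddHom.coe_mk, mul_assoc]

theorem opV_isSymmetric (G : Mat n) (y : Dual n) : (opV G y).IsSymmetric := by
  intro d e
  rw [inner_opV, real_inner_comm, inner_opV]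
  exact Finset.sum_congr rfl fun p _ => by ring

theorem inner_opV_self_nonneg (G : Mat n) (y d : Dual n) : 0 ≤ ⟪opV G y d, d⟫ := by
  rw [inner_opV]
  refine Finset.sum_nonneg fun p _ => mul_nonneg ?_ (mul_self_nonneg _)
  split_ifs <;> norm_num

theorem exists_bound_opV (n : ℕ) :
    ∃ L > 0, ∀ (G : Mat n) (y d : Dual n), ‖opV G y d‖ ≤ L * ‖d‖ := by
  obtain ⟨M, hM, h⟩ := (LinearMap.toContinuousLinearMap (opBadj n)).bound
  obtain ⟨N, hN, h'⟩ := (LinearMap.toContinuousLinearMap (opB n)).bound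
  refine ⟨N * M, by positivity, fun G y d => ?_⟩
  have hU : ‖opU (opBadj n y + G) (opBadj n d)‖ ≤ ‖opBadj n d‖ := by
    refine le_of_sq_le_sq ?_ (norm_nonneg _)
    rw [norm_sq_mat, norm_sq_mat]
    refine Finset.sum_le_sum fun p _ => ?_
    simp only [opU, LinearMap.coe_mk, AddHom.coe_mk]
    split_ifs
    · simp
    · simpa using sq_nonneg _
  calc ‖opV G y d‖ ≤ N * ‖opU (opBadj n y + G) (opBadj n d)‖ := h' _
    _ ≤ N * (M * ‖d‖) := by gcongr; exact hU.trans (h d)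
    _ = N * M * ‖d‖ := by ring

/-! ### Exact expansion around the limit point -/

/-- The entries that are strictly positive or strictly negative at `ybar` keep their sign at `y`. -/
def SignCompatible (G : Mat n) (ybar y : Dual n) : Prop :=
  ∀ p, (0 < (opBadj n ybar + G) p → 0 < (opBadj n y + G) p) ∧
    ((opBadj n ybar + G) p < 0 → (opBadj n y + G) p < 0)

theorem eventually_signCompatible (G : Mat n) (ybar : Dual n) :
    ∀ᶠ y in 𝓝 ybar, SignCompatible G ybar y := by
  refine eventually_all.2 fun p => ?_
  have hc : Continuous fun y => (opBadj n y + G) p :=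
    ((continuous_apply p).comp (PiLp.continuous_ofLp 2 _)).comp (continuous_opBadj_add G)
  refine Eventually.and ?_ ?_
  · by_cases h : 0 < (opBadj n ybar + G) p
    · filter_upwards [hc.continuousAt.eventually_const_lt h] with y hy _ using hy
    · exact Eventually.of_forall fun y h' => absurd h' h
  · by_cases h : (opBadj n ybar + G) p < 0
    · filter_upwards [hc.continuousAt.eventually_lt_const h] with y hy _ using hy
    · exact Eventually.of_forall fun y h' => absurd h' h

/-- Where the entry at `ybar` is nonzero, both positive parts lie on the same linear piece; where it
is zero, `max a 0` equals the indicator of `0 ≤ a` times `a`. This needs the mask at `y`, not at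
`ybar`. -/
theorem SignCompatible.dualGrad_sub {G : Mat n} {ybar y : Dual n} (h : SignCompatible G ybar y) :
    dualGrad G y - dualGrad G ybar = opV G y (y - ybar) := by
  simp only [dualGrad, sub_sub_sub_cancel_right, opV, LinearMap.comp_apply, ← map_sub]
  congr 1
  ext p
  have hp := h p
  simp only [matPos, opU, LinearMap.coe_mk, AddHom.coe_mk, PiLp.sub_apply]
  have e1 : opBadj n (y - ybar) p = (opBadj n y + G) p - (opBadj n ybar + G) p := by
    simp
  rw [e1]
  generalize (opBadj n y + G) p = a at *
  generalize (opBadj n ybar + G) p = b at *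
  rcases lt_trichotomy b 0 with hb | hb | hb
  · have := hp.2 hb
    rw [if_neg (by linarith), max_eq_right (by linarith), max_eq_right (by linarith)]; ring
  · subst hb
    split_ifs with h0
    · rw [max_eq_left h0]; simp
    · rw [max_eq_right (by linarith)]; simp
  · have := hp.1 hb
    rw [if_pos (by linarith), max_eq_left (by linarith), max_eq_left (by linarith)]; ring

theorem SignCompatible.dualObj_eq {G : Mat n} {ybar y : Dual n} (h : SignCompatible G ybar y) :
    dualObj G y - dualObj G ybar - ⟪dualGrad G ybar, y - ybar⟫ =
      (1 / 2) * ⟪opV G y (y - ybar), y - ybar⟫ := by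
  have h1 := dualObj_add G ybar (y - ybar)
  rw [add_sub_cancel] at h1
  rw [h1, inner_opV]
  congr 1
  refine Finset.sum_congr rfl fun p _ => ?_
  have hp := h p
  have e1 : opBadj n (y - ybar) p = (opBadj n y + G) p - (opBadj n ybar + G) p := by
    simp
  rw [e1]
  generalize (opBadj n y + G) p = a at *
  generalize (opBadj n ybar + G) p = b at *
  rw [add_sub_cancel]
  rcases lt_trichotomy b 0 with hb | hb | hb
  · have := hp.2 hb
    rw [if_neg (by linarith), max_eq_right (by linarith), max_eq_right (by linarith)]; ring
  · subst hb
    split_ifs with h0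
    · rw [max_eq_left h0]; simp; ring
    · rw [max_eq_right (by linarith)]; simp
  · have := hp.1 hb
    rw [if_pos (by linarith), max_eq_left (by linarith), max_eq_left (by linarith)]; ring

/-- The `p`-th coordinate is minimal over the cone at `X`, so its derivative vanishes along any
direction tangent together with its negative. -/
theorem eq_zero_of_mem_lineality {X H : Mat n}
    (hH : H ∈ lineality (posTangentConeAt (nonnegCone n) X)) {p : Fin n × Fin n} (hp : X p = 0) :
    H p = 0 := by
  have hmin : IsLocalMinOn (EuclideanSpace.proj p : Mat n →L[ℝ] ℝ) (nonnegCone n) X := by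
    refine IsMinOn.localize fun Y hY => ?_
    simpa [hp] using hY p
  exact hmin.hasFDerivWithinAt_eq_zero
    (EuclideanSpace.proj p : Mat n →L[ℝ] ℝ).hasFDerivWithinAt hH.1 hH.2

/-- Deletion of the entries where `X` is not positive. -/
noncomputable def posMask (X : Mat n) : Mat n →ₗ[ℝ] Mat n where
  toFun H := WithLp.toLp 2 (fun p => (if 0 < X p then (1 : ℝ) else 0) * H p)
  map_add' H K := by
    ext p
    simp [mul_add]
  map_smul' c H := by
    ext p
    simp

/-- Under constraint nondegeneracy all `𝒱(y)`, `y` near `ybar`, are uniformly positive definite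
on `Ran(ℬ)`. -/
theorem ConstraintNondegenerate.exists_coercive {G : Mat n} {ybar : Dual n}
    (hnd : ConstraintNondegenerate (metricProj (nonnegCone n) (opBadj n ybar + G))) :
    ∃ lam > 0, ∀ y, SignCompatible G ybar y → ∀ d ∈ LinearMap.range (opB n),
      lam * ‖d‖ ^ 2 ≤ ⟪opV G y d, d⟫ := by
  set Z := opBadj n ybar + G with hZ
  set T := (posMask Z ∘ₗ opBadj n) ∘ₗ (LinearMap.range (opB n)).subtype with hT
  have hker : LinearMap.ker T = ⊥ := by
    rw [LinearMap.ker_eq_bot']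
    rintro ⟨d, hd⟩ hTd
    have h0 : ∀ p, 0 < Z p → opBadj n d p = 0 := by
      intro p hp
      have := congrArg (fun X : Mat n => X p) hTd
      simpa [hT, posMask, hp] using this
    have hd' : d ∈ opB n '' lineality (posTangentConeAt (nonnegCone n)
        (metricProj (nonnegCone n) Z)) := by
      rw [hnd]; exact hd
    obtain ⟨H, hH, hHd⟩ := hd'
    -- With `d = ℬ H`, `⟨d, d⟩` is the sum of `H p * (ℬ* d) p`: the second factor vanishes where `Z
    -- p > 0`, the first elsewhere.
    have hdd : ⟪d, d⟫ = 0 := by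
      nth_rw 1 [← hHd]
      rw [inner_opB]
      refine Finset.sum_eq_zero fun p _ => ?_
      by_cases hp : 0 < Z p
      · rw [h0 p hp, mul_zero]
      · rw [eq_zero_of_mem_lineality hH, zero_mul]
        rw [metricProj_nonnegCone]
        exact max_eq_right (not_lt.1 hp)
    exact Subtype.ext (inner_self_eq_zero.1 hdd)
  obtain ⟨K, hK, hanti⟩ := T.exists_antilipschitzWith hker
  have hK' : (0 : ℝ) < K := hK
  refine ⟨((K : ℝ) ^ 2)⁻¹, by positivity, fun y hy d hd => ?_⟩
  have h1 : ‖d‖ ≤ K * ‖T ⟨d, hd⟩‖ := by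
    have := hanti.le_mul_norm (map_zero T) ⟨d, hd⟩
    simpa using this
  -- The entries positive at `ybar` remain in the mask at `y`; any others only add nonnegative
  -- terms.
  have h2 : ‖T ⟨d, hd⟩‖ ^ 2 ≤ ⟪opV G y d, d⟫ := by
    rw [norm_sq_mat, inner_opV]
    refine Finset.sum_le_sum fun p _ => ?_
    simp only [hT, posMask, LinearMap.comp_apply, LinearMap.coe_mk, AddHom.coe_mk,
      Submodule.subtype_apply]
    by_cases hp : 0 < Z p
    · rw [if_pos hp, if_pos ((hy p).1 hp).le]
      exact le_of_eq (by ring)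
    · rw [if_neg hp]
      have := mul_self_nonneg (opBadj n d p)
      split_ifs <;> simp [this]
  rw [inv_mul_le_iff₀ (by positivity)]
  calc ‖d‖ ^ 2 ≤ (K * ‖T ⟨d, hd⟩‖) ^ 2 := pow_le_pow_left₀ (norm_nonneg _) h1 2
    _ = K ^ 2 * ‖T ⟨d, hd⟩‖ ^ 2 := by ring
    _ ≤ K ^ 2 * ⟪opV G y d, d⟫ := by gcongr

/-! ### Descent and stationarity of accumulation points -/

variable {G : Mat n} {μ η τ₁ τ₂ τ δ : ℝ}

theorem newtonOp_apply (G : Mat n) (τ₁ τ₂ : ℝ) (y d : Dual n) :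
    newtonOp G τ₁ τ₂ y d = opV G y d + (τ₁ * min τ₂ ‖dualGrad G y‖) • d := by
  rw [newtonOp, gradient_dualObj]
  rfl

theorem IsNewtonDirection.residual {y d : Dual n} (h : IsNewtonDirection G η τ₁ τ₂ τ y d) :
    ‖opV G y d + (τ₁ * min τ₂ ‖dualGrad G y‖) • d + dualGrad G y‖ ≤
      min η (‖dualGrad G y‖ ^ (1 + τ)) := by
  have := h.2
  rwa [newtonOp_apply, gradient_dualObj] at this

theorem IsNewtonDirection.mem_range {y d : Dual n} (h : IsNewtonDirection G η τ₁ τ₂ τ y d) :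
    d ∈ LinearMap.range (opB n) := by
  obtain ⟨⟨k, rfl⟩, -⟩ := h
  refine cgIterate_mem (fun v hv => ?_) ?_ k
  · rw [newtonOp_apply]
    exact Submodule.add_mem _ (opV_mem_range G y v) (Submodule.smul_mem _ _ hv)
  · rw [gradient_dualObj]
    exact Submodule.neg_mem _ (dualGrad_mem_range G y)

/-- This is the CG identity for `𝒱 + ε I`. A nonzero gradient makes `ε > 0` and the operator
positive definite on the whole space; a zero gradient gives `d = 0`. -/
theorem IsNewtonDirection.inner_grad {y d : Dual n} (hτ₁ : 0 < τ₁) (hτ₂ : 0 < τ₂)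
    (h : IsNewtonDirection G η τ₁ τ₂ τ y d) :
    ⟪dualGrad G y, d⟫ = -(⟪opV G y d, d⟫ + τ₁ * min τ₂ ‖dualGrad G y‖ * ‖d‖ ^ 2) := by
  obtain ⟨⟨k, hk⟩, -⟩ := h
  rw [gradient_dualObj] at hk
  by_cases hg : dualGrad G y = 0
  · rw [hg, neg_zero, cgIterate_zero_right] at hk
    simp [hk]
  have hε : 0 < τ₁ * min τ₂ ‖dualGrad G y‖ := mul_pos hτ₁ (lt_min hτ₂ (norm_pos_iff.2 hg))
  have hexp : ∀ v, ⟪v, newtonOp G τ₁ τ₂ y v⟫ =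
      ⟪opV G y v, v⟫ + τ₁ * min τ₂ ‖dualGrad G y‖ * ‖v‖ ^ 2 := by
    intro v
    rw [newtonOp_apply, inner_add_right, inner_smul_right, real_inner_self_eq_norm_sq,
      real_inner_comm]
  have hsym : (newtonOp G τ₁ τ₂ y).IsSymmetric := by
    intro v w
    rw [newtonOp_apply, newtonOp_apply, inner_add_left, inner_add_right, inner_smul_left,
      inner_smul_right, opV_isSymmetric G y v w]
    rfl
  have h1 := inner_cgIterate hsym (fun v hv => ?_) (-dualGrad G y) k
  · rw [← hk, hexp, inner_neg_left] at h1
    linarith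
  · rw [hexp]
    have := norm_pos_iff.2 hv
    have := inner_opV_self_nonneg G y v
    positivity

theorem IsNewtonDirection.inner_grad_nonpos {y d : Dual n} (hτ₁ : 0 < τ₁) (hτ₂ : 0 < τ₂)
    (h : IsNewtonDirection G η τ₁ τ₂ τ y d) : ⟪dualGrad G y, d⟫ ≤ 0 := by
  rw [h.inner_grad hτ₁ hτ₂, neg_nonpos]
  have := inner_opV_self_nonneg G y d
  have := le_min hτ₂.le (norm_nonneg (dualGrad G y))
  positivity

theorem IsLineSearchExponent.le {y d : Dual n} {m : ℕ} (h : IsLineSearchExponent G μ δ y d m) :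
    dualObj G (y + δ ^ m • d) ≤ dualObj G y + μ * δ ^ m * ⟪dualGrad G y, d⟫ := by
  have := h.1
  rwa [Set.mem_ofPred_eq, gradient_dualObj] at this

theorem IsLineSearchExponent.le_of_le {y d : Dual n} {m i : ℕ}
    (h : IsLineSearchExponent G μ δ y d m)
    (hi : dualObj G (y + δ ^ i • d) ≤ dualObj G y + μ * δ ^ i * ⟪dualGrad G y, d⟫) : m ≤ i := by
  refine h.2 ?_
  rwa [Set.mem_ofPred_eq, gradient_dualObj]

theorem IsSsncgSequence.mem_range {y : ℕ → Dual n} (hy : IsSsncgSequence G μ η τ₁ τ₂ τ δ y)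
    (j : ℕ) : y j ∈ LinearMap.range (opB n) := by
  induction j with
  | zero => exact hy.init
  | succ j ih =>
    obtain ⟨d, m, hd, -, h⟩ := hy.step j
    rw [h]
    exact Submodule.add_mem _ ih (Submodule.smul_mem _ _ hd.mem_range)

theorem IsSsncgSequence.antitone {y : ℕ → Dual n} (hμ : 0 < μ) (hδ : 0 < δ) (hτ₁ : 0 < τ₁)
    (hτ₂ : 0 < τ₂) (hy : IsSsncgSequence G μ η τ₁ τ₂ τ δ y) :
    Antitone fun j => dualObj G (y j) := by
  refine antitone_nat_of_succ_le fun j => ?_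
  obtain ⟨d, m, hd, hm, h⟩ := hy.step j
  have h1 := hm.le
  have h2 : μ * δ ^ m * ⟪dualGrad G (y j), d⟫ ≤ 0 :=
    mul_nonpos_of_nonneg_of_nonpos (by positivity) (hd.inner_grad_nonpos hτ₁ hτ₂)
  rw [h]
  linarith

theorem IsSsncgSequence.dualObj_le {y : ℕ → Dual n} {ybar : Dual n} (hμ : 0 < μ) (hδ : 0 < δ)
    (hτ₁ : 0 < τ₁) (hτ₂ : 0 < τ₂) (hy : IsSsncgSequence G μ η τ₁ τ₂ τ δ y)
    (hybar : MapClusterPt ybar atTop y) (j : ℕ) : dualObj G ybar ≤ dualObj G (y j) := by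
  by_contra! hlt
  have h1 := (continuous_dualObj G).continuousAt.eventually_const_lt hlt
  obtain ⟨k, hk, hjk⟩ := ((hybar.frequently h1).and_eventually (eventually_ge_atTop j)).exists
  exact absurd (hy.antitone hμ hδ hτ₁ hτ₂ hjk) (not_le.2 hk)

/-- Near a point with nonzero gradient one step of the algorithm decreases the objective by at
least a fixed amount. -/
theorem exists_decrease (hμ : μ ∈ Set.Ioo (0 : ℝ) (1 / 2)) (hη : η ∈ Set.Ioo (0 : ℝ) 1)
    (hτ₁ : 0 < τ₁) (hτ₂ : 0 < τ₂) (hτ : 0 < τ) (hδ : δ ∈ Set.Ioo (0 : ℝ) 1) {ybar : Dual n}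
    (hg : dualGrad G ybar ≠ 0) :
    ∃ Δ > 0, ∀ᶠ y in 𝓝 ybar, ∀ d m, IsNewtonDirection G η τ₁ τ₂ τ y d →
      IsLineSearchExponent G μ δ y d m →
      dualObj G (y + δ ^ m • d) ≤ dualObj G y - Δ := by
  obtain ⟨hμ0, hμ1⟩ := hμ
  obtain ⟨hη0, hη1⟩ := hη
  obtain ⟨hδ0, hδ1⟩ := hδ
  obtain ⟨L, hL, hLb⟩ := exists_bound_opBadj n
  obtain ⟨M, hM, hMb⟩ := exists_bound_opV n
  have hγ : 0 < ‖dualGrad G ybar‖ := norm_pos_iff.2 hg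
  set γ := ‖dualGrad G ybar‖ with hγdef
  -- The residual tolerance is strictly below the gradient norm, which keeps `d` away from zero: the
  -- power does this if `γ < 1`, and `η < 1` otherwise.
  have hres : 0 < γ - min η (γ ^ (1 + τ)) := by
    rw [sub_pos]
    rcases lt_or_ge γ 1 with h1 | h1
    · refine (min_le_right _ _).trans_lt ?_
      have := Real.rpow_lt_rpow_of_exponent_gt hγ h1 (show (1 : ℝ) < 1 + τ by linarith)
      rwa [Real.rpow_one] at this
    · exact (min_le_left _ _).trans_lt (hη1.trans_le h1)
  set ρ := (γ - min η (γ ^ (1 + τ))) / 2 with hρ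
  have hρ0 : 0 < ρ := by positivity
  set ε := τ₁ * min τ₂ (γ / 2) with hε
  have hε0 : 0 < ε := mul_pos hτ₁ (lt_min hτ₂ (by positivity))
  -- The step `δ ^ i` with `δ ^ i * L ≤ ε` passes the line search uniformly near `ybar`, so the
  -- accepted step is at least `δ ^ i`.
  obtain ⟨i, hi⟩ := exists_pow_lt_of_lt_one (show (0 : ℝ) < ε / L by positivity) hδ1
  have hcn : Continuous fun y => ‖dualGrad G y‖ := (continuous_dualGrad G).norm
  have hcr : Continuous fun y => ‖dualGrad G y‖ - min η (‖dualGrad G y‖ ^ (1 + τ)) :=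
    hcn.sub (continuous_const.min (hcn.rpow_const fun _ => Or.inr (by linarith)))
  have e1 : ∀ᶠ y in 𝓝 ybar, γ / 2 < ‖dualGrad G y‖ :=
    hcn.continuousAt.eventually_const_lt (by linarith)
  have e2 : ∀ᶠ y in 𝓝 ybar, ρ < ‖dualGrad G y‖ - min η (‖dualGrad G y‖ ^ (1 + τ)) :=
    hcr.continuousAt.eventually_const_lt (by rw [hρ]; linarith)
  refine ⟨μ * δ ^ i * (ε * (ρ / (M + τ₁ * τ₂)) ^ 2), by positivity, ?_⟩
  filter_upwards [e1, e2] with y h1 h2 d m hd hm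
  set εy := τ₁ * min τ₂ ‖dualGrad G y‖ with hεy
  have hεle : ε ≤ εy := mul_le_mul_of_nonneg_left (min_le_min le_rfl h1.le) hτ₁.le
  have hεy' : εy ≤ τ₁ * τ₂ := mul_le_mul_of_nonneg_left (min_le_left _ _) hτ₁.le
  have hV := inner_opV_self_nonneg G y d
  have hin := hd.inner_grad hτ₁ hτ₂
  rw [← hεy] at hin
  have hdesc : ε * ‖d‖ ^ 2 ≤ -⟪dualGrad G y, d⟫ := by
    nlinarith [mul_le_mul_of_nonneg_right hεle (sq_nonneg ‖d‖)]
  have hdlow : ρ / (M + τ₁ * τ₂) ≤ ‖d‖ := by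
    rw [div_le_iff₀ (by positivity)]
    have h3 := hd.residual
    rw [← hεy] at h3
    have h4 : ‖dualGrad G y‖ ≤ ‖opV G y d + εy • d + dualGrad G y‖ + ‖opV G y d + εy • d‖ := by
      have := norm_sub_le (opV G y d + εy • d + dualGrad G y) (opV G y d + εy • d)
      rwa [add_sub_cancel_left] at this
    have h5 : ‖opV G y d + εy • d‖ ≤ M * ‖d‖ + τ₁ * τ₂ * ‖d‖ := by
      refine (norm_add_le _ _).trans (add_le_add (hMb G y d) ?_)
      rw [norm_smul, Real.norm_of_nonneg (hε0.le.trans hεle)]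
      gcongr
    nlinarith
  have harm : dualObj G (y + δ ^ i • d) ≤ dualObj G y + μ * δ ^ i * ⟪dualGrad G y, d⟫ := by
    have h3 := (dualObj_add_bounds G y (δ ^ i • d)).2
    have h4 := hLb d
    have ht : 0 < δ ^ i := by positivity
    have h5 : δ ^ i * L ≤ ε := by rw [← le_div_iff₀ hL]; exact hi.le
    rw [map_smul, norm_smul, mul_pow, Real.norm_of_nonneg ht.le, inner_smul_right] at h3
    generalize δ ^ i = t at *
    have h6 : t * ‖opBadj n d‖ ^ 2 ≤ -⟪dualGrad G y, d⟫ :=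
      calc t * ‖opBadj n d‖ ^ 2 ≤ t * (L * ‖d‖ ^ 2) := by gcongr
        _ = t * L * ‖d‖ ^ 2 := by ring
        _ ≤ ε * ‖d‖ ^ 2 := by gcongr
        _ ≤ _ := hdesc
    have h7 : (0 : ℝ) ≤ -⟪dualGrad G y, d⟫ := le_trans (by positivity) hdesc
    have h8 := mul_le_mul_of_nonneg_left h6 ht.le
    -- The quadratic term consumes at most half of the linear decrease; `μ < 1 / 2` leaves enough.
    have h9 : μ * (t * -⟪dualGrad G y, d⟫) ≤ 1 / 2 * (t * -⟪dualGrad G y, d⟫) := by gcongr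
    linarith
  have hmi := hm.le_of_le harm
  have hpow : δ ^ i ≤ δ ^ m := pow_le_pow_of_le_one hδ0.le hδ1.le hmi
  have h6 : μ * δ ^ i * (ε * (ρ / (M + τ₁ * τ₂)) ^ 2) ≤ μ * δ ^ m * -⟪dualGrad G y, d⟫ := by
    gcongr
    refine le_trans ?_ hdesc
    gcongr
  linarith [hm.le]

theorem IsSsncgSequence.dualGrad_eq_zero {y : ℕ → Dual n} {ybar : Dual n}
    (hμ : μ ∈ Set.Ioo (0 : ℝ) (1 / 2)) (hη : η ∈ Set.Ioo (0 : ℝ) 1)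
    (hτ₁ : 0 < τ₁) (hτ₂ : 0 < τ₂) (hτ : 0 < τ) (hδ : δ ∈ Set.Ioo (0 : ℝ) 1)
    (hy : IsSsncgSequence G μ η τ₁ τ₂ τ δ y) (hybar : MapClusterPt ybar atTop y) :
    dualGrad G ybar = 0 := by
  by_contra hg
  obtain ⟨Δ, hΔ, hdec⟩ := exists_decrease hμ hη hτ₁ hτ₂ hτ hδ hg
  have h1 := (continuous_dualObj G).continuousAt.eventually_lt_const
    (show dualObj G ybar < dualObj G ybar + Δ by linarith)
  obtain ⟨j, hj1, hj2⟩ := (hybar.frequently (h1.and hdec)).exists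
  obtain ⟨d, m, hd, hm, h⟩ := hy.step j
  have h2 := hj2 d m hd hm
  rw [← h] at h2
  linarith [hy.dualObj_le hμ.1 hδ.1 hτ₁ hτ₂ hybar (j + 1)]

/-! ### Local rate and acceptance of unit steps -/

/-- Near a nondegenerate stationary point the full inexact Newton step contracts the distance with
order `1 + τ`. -/
theorem exists_newton_contraction (hτ₁ : τ₁ ∈ Set.Ioo (0 : ℝ) 1) (hτ₂ : 0 < τ₂)
    (hτ : τ ∈ Set.Ioc (0 : ℝ) 1) {ybar : Dual n} (hyr : ybar ∈ LinearMap.range (opB n))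
    (hg : dualGrad G ybar = 0) {lam : ℝ} (hlam : 0 < lam)
    (hco : ∀ y, SignCompatible G ybar y → ∀ d ∈ LinearMap.range (opB n),
      lam * ‖d‖ ^ 2 ≤ ⟪opV G y d, d⟫) :
    ∃ K > 0, ∀ y ∈ LinearMap.range (opB n), SignCompatible G ybar y → ‖y - ybar‖ ≤ 1 →
      ∀ d, IsNewtonDirection G η τ₁ τ₂ τ y d → ‖y + d - ybar‖ ≤ K * ‖y - ybar‖ ^ (1 + τ) := by
  obtain ⟨M, hM, hMb⟩ := exists_bound_opV n
  refine ⟨(M ^ (1 + τ) + M) / lam, by positivity, fun y hyR hs he1 d hd => ?_⟩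
  set e := y - ybar with he
  set e' := y + d - ybar with he'
  set g := dualGrad G y with hgdef
  set ε := τ₁ * min τ₂ ‖g‖ with hε
  have hτ₁0 := hτ₁.1
  have hε0 : 0 ≤ ε := mul_nonneg hτ₁0.le (le_min hτ₂.le (norm_nonneg _))
  have hgV : g = opV G y e := by
    rw [← hs.dualGrad_sub, hg, sub_zero]
  have hgn : ‖g‖ ≤ M * ‖e‖ := by rw [hgV]; exact hMb G y e
  have hee : e' = e + d := by rw [he, he']; abel
  have hmem : e' ∈ LinearMap.range (opB n) :=
    Submodule.sub_mem _ (Submodule.add_mem _ hyR hd.mem_range) hyr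
  have hεn : ε ≤ M * ‖e‖ :=
    calc ε ≤ 1 * ‖g‖ := mul_le_mul hτ₁.2.le (min_le_right _ _)
          (le_min hτ₂.le (norm_nonneg _)) zero_le_one
      _ ≤ M * ‖e‖ := by rwa [one_mul]
  have hres : ‖opV G y d + ε • d + g‖ ≤ M ^ (1 + τ) * ‖e‖ ^ (1 + τ) := by
    refine (hd.residual.trans (min_le_right _ _)).trans ?_
    rw [← Real.mul_rpow hM.le (norm_nonneg _)]
    exact Real.rpow_le_rpow (norm_nonneg _) hgn (by linarith [hτ.1])
  -- The regularization error is quadratic, hence of order `1 + τ` because `τ ≤ 1` and `‖e‖ ≤ 1`.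
  have hsq : ε * ‖e‖ ≤ M * ‖e‖ ^ (1 + τ) := by
    have h1 : ‖e‖ * ‖e‖ ≤ ‖e‖ ^ (1 + τ) := by
      rcases (norm_nonneg e).eq_or_lt with h0 | h0
      · rw [← h0, zero_mul]; positivity
      · have := Real.rpow_le_rpow_of_exponent_ge h0 he1 (show 1 + τ ≤ (2 : ℝ) by linarith [hτ.2])
        rwa [Real.rpow_two, sq] at this
    calc ε * ‖e‖ ≤ M * ‖e‖ * ‖e‖ := by gcongr
      _ = M * (‖e‖ * ‖e‖) := by ring
      _ ≤ _ := by gcongr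
  -- As `g = 𝒱 e`, the new error solves the Newton system with only the CG residual and `ε • e` on
  -- the right.
  have hsys : opV G y e' + ε • e' = (opV G y d + ε • d + g) + ε • e := by
    rw [hee, hgV, map_add, smul_add]; abel
  have hmain : lam * ‖e'‖ ^ 2 ≤ (M ^ (1 + τ) + M) * ‖e‖ ^ (1 + τ) * ‖e'‖ :=
    calc lam * ‖e'‖ ^ 2 ≤ ⟪opV G y e', e'⟫ + ε * ‖e'‖ ^ 2 := by
          have := hco y hs e' hmem
          have : 0 ≤ ε * ‖e'‖ ^ 2 := by positivity
          linarith
      _ = ⟪opV G y e' + ε • e', e'⟫ := by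
          rw [inner_add_left, inner_smul_left, real_inner_self_eq_norm_sq]; rfl
      _ ≤ ‖opV G y e' + ε • e'‖ * ‖e'‖ := real_inner_le_norm _ _
      _ ≤ (M ^ (1 + τ) + M) * ‖e‖ ^ (1 + τ) * ‖e'‖ := by
          gcongr
          rw [hsys]
          refine (norm_add_le _ _).trans ?_
          rw [norm_smul, Real.norm_of_nonneg hε0]
          linarith
  rw [div_mul_eq_mul_div, le_div_iff₀ hlam]
  rcases (norm_nonneg e').eq_or_lt with h0 | h0
  · rw [← h0, zero_mul]; positivity
  · refine le_of_mul_le_mul_right ?_ h0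
    linarith

/-- The full step is accepted by the line search once it is sufficiently contracting. -/
theorem exists_unit_step (hμ : μ ∈ Set.Ioo (0 : ℝ) (1 / 2)) {ybar : Dual n}
    (hyr : ybar ∈ LinearMap.range (opB n)) (hg : dualGrad G ybar = 0) {lam : ℝ} (hlam : 0 < lam)
    (hco : ∀ y, SignCompatible G ybar y → ∀ d ∈ LinearMap.range (opB n),
      lam * ‖d‖ ^ 2 ≤ ⟪opV G y d, d⟫) :
    ∃ s > 0, s ≤ 1 / 2 ∧ ∀ y ∈ LinearMap.range (opB n), SignCompatible G ybar y → ∀ d,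
      ‖y + d - ybar‖ ≤ s * ‖y - ybar‖ →
      dualObj G (y + d) ≤ dualObj G y + μ * ⟪dualGrad G y, d⟫ := by
  obtain ⟨hμ0, hμ1⟩ := hμ
  obtain ⟨L, hL, hLb⟩ := exists_bound_opBadj n
  obtain ⟨M, hM, hMb⟩ := exists_bound_opV n
  have hq : 0 < (1 / 2 - μ) * lam / (M + L) := by
    have : 0 < 1 / 2 - μ := by linarith
    positivity
  refine ⟨min (1 / 2) ((1 / 2 - μ) * lam / (M + L)), lt_min (by norm_num) hq, min_le_left _ _,
    fun y hyR hs d hd => ?_⟩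
  set s := min (1 / 2) ((1 / 2 - μ) * lam / (M + L)) with hsdef
  have hs0 : 0 < s := lt_min (by norm_num) hq
  have hs1 : s ≤ 1 / 2 := min_le_left _ _
  have hs2 : s * (M + L) ≤ (1 / 2 - μ) * lam := by
    rw [← le_div_iff₀ (by positivity)]; exact min_le_right _ _
  set e := y - ybar with he
  set e' := y + d - ybar with he'
  have hgV : dualGrad G y = opV G y e := by
    rw [← hs.dualGrad_sub, hg, sub_zero]
  have hphi := hs.dualObj_eq
  rw [hg, inner_zero_left, sub_zero, ← he] at hphi
  -- The global quadratic bound suffices here, so `y + d` need not be sign compatible.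
  have hphi' := (dualObj_add_bounds G ybar e').2
  rw [hg, inner_zero_left, sub_zero, show ybar + e' = y + d by rw [he']; abel] at hphi'
  have hd' : d = e' - e := by rw [he, he']; abel
  have hin : ⟪dualGrad G y, d⟫ = ⟪opV G y e, e'⟫ - ⟪opV G y e, e⟫ := by
    rw [hgV, hd', inner_sub_right]
  have hcoe := hco y hs e (Submodule.sub_mem _ hyR hyr)
  have h1 : -⟪opV G y e, e'⟫ ≤ M * s * ‖e‖ ^ 2 :=
    calc -⟪opV G y e, e'⟫ ≤ ‖opV G y e‖ * ‖e'‖ :=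
          (neg_le_abs _).trans (abs_real_inner_le_norm _ _)
      _ ≤ (M * ‖e‖) * (s * ‖e‖) := by gcongr; exact hMb G y e
      _ = M * s * ‖e‖ ^ 2 := by ring
  have h2 : ‖opBadj n e'‖ ^ 2 ≤ L * s * ‖e‖ ^ 2 :=
    calc ‖opBadj n e'‖ ^ 2 ≤ L * ‖e'‖ ^ 2 := hLb e'
      _ ≤ L * (s * ‖e‖) ^ 2 := by gcongr
      _ = L * s * ‖e‖ ^ 2 * s := by ring
      _ ≤ L * s * ‖e‖ ^ 2 * 1 := by gcongr; linarith
      _ = L * s * ‖e‖ ^ 2 := mul_one _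
  have h3 : (s * (M + L)) * ‖e‖ ^ 2 ≤ (1 / 2 - μ) * ⟪opV G y e, e⟫ := by
    have h4 := mul_le_mul_of_nonneg_left hcoe (show 0 ≤ 1 / 2 - μ by linarith)
    have h5 := mul_le_mul_of_nonneg_right hs2 (sq_nonneg ‖e‖)
    linarith
  have h4 : μ * -⟪opV G y e, e'⟫ ≤ M * s * ‖e‖ ^ 2 := by
    have h5 := mul_le_mul_of_nonneg_left h1 hμ0.le
    have h6 : μ * (M * s * ‖e‖ ^ 2) ≤ 1 * (M * s * ‖e‖ ^ 2) := by gcongr; linarith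
    linarith
  have h5 : 0 ≤ L * s * ‖e‖ ^ 2 := by positivity
  rw [hin]
  linarith

end Birkhoff

/-! ### Trapping of the sequence -/

theorem mainTheorem7 {n : ℕ} (G : Birkhoff.Mat n) (μ η τ₁ τ₂ τ δ : ℝ)
    (hμ : μ ∈ Set.Ioo (0 : ℝ) (1 / 2)) (hη : η ∈ Set.Ioo (0 : ℝ) 1)
    (hτ₁ : τ₁ ∈ Set.Ioo (0 : ℝ) 1) (hτ₂ : τ₂ ∈ Set.Ioo (0 : ℝ) 1)
    (hτ : τ ∈ Set.Ioc (0 : ℝ) 1) (hδ : δ ∈ Set.Ioo (0 : ℝ) 1)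
    (y : ℕ → Birkhoff.Dual n) (hy : Birkhoff.IsSsncgSequence G μ η τ₁ τ₂ τ δ y)
    (ybar : Birkhoff.Dual n) (hybar : MapClusterPt ybar atTop y)
    (hnd : Birkhoff.ConstraintNondegenerate
      (Birkhoff.metricProj (Birkhoff.nonnegCone n) (Birkhoff.opBadj n ybar + G))) :
    Tendsto y atTop (𝓝 ybar) ∧
      (fun j => y (j + 1) - ybar) =O[atTop] (fun j => ‖y j - ybar‖ ^ (1 + τ)) := by
  have hg := hy.dualGrad_eq_zero hμ hη hτ₁.1 hτ₂.1 hτ.1 hδ hybar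
  have hyr : ybar ∈ LinearMap.range (Birkhoff.opB n) :=
    (LinearMap.range (Birkhoff.opB n)).closed_of_finiteDimensional.mem_of_mapClusterPt hybar
      (Eventually.of_forall hy.mem_range)
  obtain ⟨lam, hlam, hco⟩ := hnd.exists_coercive
  obtain ⟨K, hK, hcontr⟩ :=
    Birkhoff.exists_newton_contraction (η := η) hτ₁ hτ₂.1 hτ hyr hg hlam hco
  obtain ⟨s, hs0, hs1, hunit⟩ := Birkhoff.exists_unit_step hμ hyr hg hlam hco
  -- This turns the bound `K * ‖e‖ ^ (1 + τ)` into the contraction `s * ‖e‖` that the unit step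
  -- requires.
  have hsmall : ∀ᶠ x in 𝓝 ybar, K * ‖x - ybar‖ ^ τ < s := by
    have hc : Continuous fun x : Birkhoff.Dual n => K * ‖x - ybar‖ ^ τ :=
      continuous_const.mul ((continuous_id.sub continuous_const).norm.rpow_const
        fun _ => Or.inr hτ.1.le)
    refine hc.continuousAt.eventually_lt_const ?_
    simpa [Real.zero_rpow hτ.1.ne'] using hs0
  obtain ⟨r, hr, hball⟩ := Metric.eventually_nhds_iff_ball.1
    ((Birkhoff.eventually_signCompatible G ybar).and
      (hsmall.and (Metric.ball_mem_nhds ybar one_pos)))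
  have hstep : ∀ j, y j ∈ Metric.ball ybar r →
      ‖y (j + 1) - ybar‖ ≤ K * ‖y j - ybar‖ ^ (1 + τ) ∧
        ‖y (j + 1) - ybar‖ ≤ (1 / 2) * ‖y j - ybar‖ := by
    intro j hj
    obtain ⟨hsign, hKs, h1⟩ := hball _ hj
    rw [dist_eq_norm] at h1
    obtain ⟨d, m, hd, hm, h⟩ := hy.step j
    have hfull := hcontr _ (hy.mem_range j) hsign h1.le d hd
    have hfull' : ‖y j + d - ybar‖ ≤ s * ‖y j - ybar‖ := by
      refine hfull.trans ?_
      rw [Real.rpow_add' (norm_nonneg _) (by linarith [hτ.1]), Real.rpow_one, mul_left_comm,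
        mul_comm]
      gcongr
    have hm0 : m = 0 := by
      refine Nat.le_zero.1 (hm.le_of_le ?_)
      simpa using hunit _ (hy.mem_range j) hsign d hfull'
    rw [hm0, pow_zero, one_smul] at h
    rw [h]
    exact ⟨hfull, hfull'.trans (by gcongr)⟩
  -- One visit to the ball is enough: every later step at least halves the distance.
  obtain ⟨J, hJ⟩ := (hybar.frequently (Metric.ball_mem_nhds ybar hr)).exists
  have hgeo : ∀ k, y (J + k) ∈ Metric.ball ybar r ∧
      ‖y (J + k) - ybar‖ ≤ (1 / 2) ^ k * ‖y J - ybar‖ := by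
    intro k
    induction k with
    | zero => exact ⟨hJ, by simp⟩
    | succ k ih =>
      have h1 := (hstep _ ih.1).2
      have h2 := mem_ball_iff_norm.1 ih.1
      rw [← add_assoc]
      refine ⟨mem_ball_iff_norm.2 (by linarith [norm_nonneg (y (J + k) - ybar)]), ?_⟩
      rw [pow_succ]
      linarith [ih.2]
  constructor
  · rw [tendsto_iff_norm_sub_tendsto_zero, ← tendsto_add_atTop_iff_nat J]
    have h0 : Tendsto (fun k : ℕ => (1 / 2 : ℝ) ^ k * ‖y J - ybar‖) atTop (𝓝 0) := by
      have := (tendsto_pow_atTop_nhds_zero_of_lt_one (r := (1 / 2 : ℝ)) (by norm_num)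
        (by norm_num)).mul_const ‖y J - ybar‖
      rwa [zero_mul] at this
    refine squeeze_zero (fun _ => norm_nonneg _) (fun k => ?_) h0
    rw [add_comm k J]
    exact (hgeo k).2
  · refine IsBigO.of_bound K ?_
    filter_upwards [eventually_ge_atTop J] with j hj
    obtain ⟨k, rfl⟩ := Nat.exists_eq_add_of_le hj
    rw [Real.norm_of_nonneg (by positivity)]
    exact (hstep _ (hgeo k).1).1
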